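/- Let $\mathcal{X}$ be a countable set (with the discrete $\sigma$-algebra), let $n \in \mathbb{N}$ and $\rho \in \mathbb{R}$, and equip $\{0,1\}^{\mathcal{X}}$ with the product $\sigma$-algebra. A learning rule $A$ assigns to every sample $S \in (\mathcal{X}\times\{0,1\})^n$ a probability measure $A(S)$ on $\{0,1\}^{\mathcal{X}}$, its posterior; a learning algorithm $A'$ consists of a probability space $\mathcal{R}$ and a measurable map $(S,r) \mapsto A'(S,r) \in \{0,1\}^{\mathcal{X}}$, and it induces the learning rule $A'(S)$, the law of $A'(S,r)$ for $r \sim \mathcal{R}$. Write $d_{\mathrm{TV}}(P,Q) = \sup_E \big(P(E) - Q(E)\big)$, the supremum being over measurable $E$. Suppose that $A$ is an $n$-sample $\rho$-TV indistinguishable learning rule, that is, for every probability distribution $\mathcal{D}$ on $\mathcal{X}\times\{0,1\}$, \[ \mathbf{E}_{S,S' \sim \mathcal{D}^n}\big[d_{\mathrm{TV}}(A(S),A(S'))\big] \le \rho , \] where $S$ and $S'$ are independent. Then there is a learning algorithm $A'$ that is equivalent to $A$, i.e. $A'(S) = A(S)$ as distributions for every sample $S \in (\mathcal{X}\times\{0,1\})^n$,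 and that is $n$-sample $\frac{2\rho}{1+\rho}$-replicable, i.e. for every probability distribution $\mathcal{D}$ on $\mathcal{X}\times\{0,1\}$, \[ \Pr_{S,S' \sim \mathcal{D}^n,\; r \sim \mathcal{R}}\big[A'(S,r) \ne A'(S',r)\big] \le \frac{2\rho}{1+\rho}, \] where $S$, $S'$ and $r$ are independent. Moreover, for every enumeration $(S_i)_{i \ge 1}$ (possibly with repetitions) of all the samples in $(\mathcal{X}\times\{0,1\})^n$, the mixture $\mathcal{P} = \sum_{i=1}^{\infty} 2^{-i} A(S_i)$ is a probability measure on $\{0,1\}^{\mathcal{X}}$, and $A$ is absolutely continuous with respect to $\mathcal{P}$: for every probability distribution $\mathcal{D}$ on $\mathcal{X}\times\{0,1\}$, $A(S) \ll \mathcal{P}$ for $\mathcal{D}^n$-almost every $S$. -/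

import Mathlib

open MeasureTheory

open scoped ENNReal

universe u

/-- A sample of size `n`: a sequence of `n` labelled examples from `X × {0,1}`. -/
abbrev LabeledSample (X : Type u) (n : ℕ) : Type u := Fin n → X × Bool

/-- A learning rule: it maps a sample of size `n` to a probability distribution (the posterior) over
binary classifiers `X → {0,1}`, where `{0,1}^X` carries the product σ-algebra. -/
abbrev LearningRule (X : Type u) (n : ℕ) : Type u :=
  LabeledSample X n → ProbabilityMeasure (X → Bool)

/-- A learning algorithm: a source of internal randomness (a probability space `Seed` with
distribution `law`) and a deterministic map taking a sample and a random seed to a classifier. -/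
structure LearningAlgorithm (X : Type u) [MeasurableSpace X] (n : ℕ) where
  Seed : Type u
  [seedMeasurableSpace : MeasurableSpace Seed]
  law : ProbabilityMeasure Seed
  run : LabeledSample X n → Seed → (X → Bool)
  measurable_run : Measurable (Function.uncurry run)

attribute [instance] LearningAlgorithm.seedMeasurableSpace

/-- The learning rule induced by a learning algorithm: the distribution of `run S r` for a random
seed `r`. -/
noncomputable def LearningAlgorithm.rule {X : Type u} [MeasurableSpace X] {n : ℕ}
    (B : LearningAlgorithm X n) : LearningRule X n :=
  fun S => B.law.map (f := B.run S) (B.measurable_run.of_uncurry_left (x := S)).aemeasurable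

/-- The distribution of `n` i.i.d. draws from `D`. -/
noncomputable def iidSample {X : Type u} [MeasurableSpace X] (n : ℕ)
    (D : ProbabilityMeasure (X × Bool)) : Measure (LabeledSample X n) :=
  Measure.pi fun _ => (D : Measure (X × Bool))

/-- Total variation distance: the supremum of `P(E) - Q(E)` over measurable events `E`. -/
noncomputable def tvDistance {Ω : Type*} [MeasurableSpace Ω] (P Q : ProbabilityMeasure Ω) : ℝ :=
  ⨆ E : {E : Set Ω // MeasurableSet E},
    ((P : Measure Ω).real E.1 - (Q : Measure Ω).real E.1)

/-- `n`-sample `ρ`-TV indistinguishability: for every distribution `D`, the expected total variation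
distance of the posteriors on two independent samples is at most `ρ`. -/
def IsTVIndistinguishable {X : Type u} [MeasurableSpace X] {n : ℕ}
    (A : LearningRule X n) (ρ : ℝ) : Prop :=
  ∀ D : ProbabilityMeasure (X × Bool),
    ∫ p : LabeledSample X n × LabeledSample X n, tvDistance (A p.1) (A p.2)
      ∂((iidSample n D).prod (iidSample n D)) ≤ ρ

/-- `n`-sample `ρ`-replicability: for every distribution `D`, two executions on independent samples
`S`, `S'` with the same random seed `r` differ with probability at most `ρ`. -/
def LearningAlgorithm.IsReplicable {X : Type u} [MeasurableSpace X] {n : ℕ}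
    (B : LearningAlgorithm X n) (ρ : ℝ) : Prop :=
  ∀ D : ProbabilityMeasure (X × Bool),
    (((iidSample n D).prod (iidSample n D)).prod (B.law : Measure B.Seed)).real
      {q | B.run q.1.1 q.2 ≠ B.run q.1.2 q.2} ≤ ρ

/-- Two learning rules are equivalent if they have the same posterior on every sample. -/
def LearningRule.Equivalent {X : Type u} {n : ℕ} (A A' : LearningRule X n) : Prop :=
  ∀ S, A S = A' S

/-- `A` is absolutely continuous with respect to the measure `P`: for every distribution `D`, the
posterior of almost every sample drawn from `D` is absolutely continuous with respect to `P`. -/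
def LearningRule.IsAbsolutelyContinuous {X : Type u} [MeasurableSpace X] {n : ℕ}
    (A : LearningRule X n) (P : Measure (X → Bool)) : Prop :=
  ∀ D : ProbabilityMeasure (X × Bool),
    ∀ᵐ S ∂(iidSample n D), (A S : Measure (X → Bool)) ≪ P

/-- The mixture `∑ i ≥ 1, 2⁻ⁱ A(Sᵢ)` of the posteriors along a sequence of samples (indexed
here from `0`). -/
noncomputable def LearningRule.mixture {X : Type u} {n : ℕ}
    (A : LearningRule X n) (s : ℕ → LabeledSample X n) : Measure (X → Bool) :=
  Measure.sum fun i => (2⁻¹ : ℝ≥0∞) ^ (i + 1) • (A (s i) : Measure (X → Bool))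

theorem bddAbove_measureReal_sub {Ω : Type*} [MeasurableSpace Ω] (P Q : ProbabilityMeasure Ω) :
    BddAbove (Set.range fun E : {E : Set Ω // MeasurableSet E} =>
      ((P : Measure Ω).real E.1 - (Q : Measure Ω).real E.1)) := by
  refine ⟨1, ?_⟩
  rintro _ ⟨E, rfl⟩
  have h₁ : (P : Measure Ω).real E.1 ≤ 1 := measureReal_le_one
  have h₂ : 0 ≤ (Q : Measure Ω).real E.1 := measureReal_nonneg
  dsimp only
  linarith

theorem measureReal_sub_le_tvDistance {Ω : Type*} [MeasurableSpace Ω] (P Q : ProbabilityMeasure Ω)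
    {E : Set Ω} (hE : MeasurableSet E) :
    (P : Measure Ω).real E - (Q : Measure Ω).real E ≤ tvDistance P Q :=
  le_ciSup (bddAbove_measureReal_sub P Q) ⟨E, hE⟩

theorem tvDistance_nonneg {Ω : Type*} [MeasurableSpace Ω] (P Q : ProbabilityMeasure Ω) :
    0 ≤ tvDistance P Q := by
  simpa using measureReal_sub_le_tvDistance P Q MeasurableSet.empty

theorem tvDistance_le_one {Ω : Type*} [MeasurableSpace Ω] (P Q : ProbabilityMeasure Ω) :
    tvDistance P Q ≤ 1 := by
  have : Nonempty {E : Set Ω // MeasurableSet E} := ⟨⟨∅, MeasurableSet.empty⟩⟩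
  refine ciSup_le fun E => ?_
  have h₁ : (P : Measure Ω).real E.1 ≤ 1 := measureReal_le_one
  have h₂ : 0 ≤ (Q : Measure Ω).real E.1 := measureReal_nonneg
  linarith

/-- For a height function `h` with values in `[0, 1]`, the mass of the region under its graph. -/
theorem prod_restrict_Ioo_regionBetween {Ω : Type*} [MeasurableSpace Ω] (P : Measure Ω) [SFinite P]
    {h : Ω → ℝ} (hm : Measurable h) (h1 : ∀ ω, h ω ≤ 1) {E : Set Ω} (hE : MeasurableSet E) :
    (P.prod (volume.restrict (Set.Ioo (0 : ℝ) 1))) (regionBetween 0 h E)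
      = ∫⁻ ω in E, ENNReal.ofReal (h ω) ∂P := by
  have hreg : MeasurableSet (regionBetween 0 h E) :=
    measurableSet_regionBetween measurable_const hm hE
  rw [← Measure.restrict_univ (μ := P), Measure.prod_restrict, Measure.restrict_univ,
    Measure.restrict_apply hreg, Set.inter_eq_left.2,
    volume_regionBetween_eq_lintegral (f := 0) (g := h) measurable_const.aemeasurable
      hm.aemeasurable hE]
  · simp
  · rintro ⟨ω, t⟩ ⟨-, ht0, ht1⟩
    exact ⟨trivial, ht0, ht1.trans_le (h1 ω)⟩

theorem exists_acceptanceRegions {Ω ι : Type*} [MeasurableSpace Ω] (M : ι → ProbabilityMeasure Ω)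
    (F : Finset ι) (hF : F.Nonempty) :
    ∃ (ν : Measure (Ω × ℝ)) (G : ι → Set (Ω × ℝ)) (c : ℝ), IsProbabilityMeasure ν ∧
      0 < c ∧ c ≤ 1 ∧ (∀ i, MeasurableSet (G i)) ∧
      (∀ i ∈ F, ∀ E, MeasurableSet E →
        ν.real (G i ∩ Prod.fst ⁻¹' E) = c * (M i : Measure Ω).real E) ∧
      (∀ i ∈ F, ∀ j ∈ F, c * (1 - tvDistance (M i) (M j)) ≤ ν.real (G i ∩ G j)) := by
  classical
  set Q : Measure Ω := ∑ i ∈ F, (M i : Measure Ω) with hQ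
  have hm0 : (F.card : ℝ≥0∞) ≠ 0 := by simpa using hF.ne_empty
  set P : Measure Ω := (F.card : ℝ≥0∞)⁻¹ • Q with hP
  have hQu : Q Set.univ = F.card := by simp [hQ]
  have : IsFiniteMeasure Q := ⟨by simp [hQu]⟩
  have : IsProbabilityMeasure P := ⟨by
    rw [hP, Measure.smul_apply, hQu, smul_eq_mul, ENNReal.inv_mul_cancel hm0 (by simp)]⟩
  have : IsProbabilityMeasure (volume.restrict (Set.Ioo (0 : ℝ) 1)) := ⟨by simp⟩
  set ν := P.prod (volume.restrict (Set.Ioo (0 : ℝ) 1)) with hν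
  set h : ι → Ω → ℝ := fun i ω => (min ((M i : Measure Ω).rnDeriv Q ω) 1).toReal with hh
  have hmeas : ∀ i, Measurable (h i) := fun i =>
    ((Measure.measurable_rnDeriv _ _).min measurable_const).ennreal_toReal
  have hle : ∀ i ω, h i ω ≤ 1 := fun i ω =>
    ENNReal.toReal_mono ENNReal.one_ne_top (min_le_right _ _)
  have hinter : ∀ i E, regionBetween 0 (h i) Set.univ ∩ Prod.fst ⁻¹' E
      = regionBetween 0 (h i) E := by
    intro i E
    ext y
    simp [regionBetween, and_comm]
  have hG : ∀ i ∈ F, ∀ E, MeasurableSet E →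
      ν.real (regionBetween 0 (h i) Set.univ ∩ Prod.fst ⁻¹' E)
        = (F.card : ℝ)⁻¹ * (M i : Measure Ω).real E := by
    intro i hi E hE
    have hMQ : (M i : Measure Ω) ≤ Q :=
      Finset.single_le_sum (f := fun i => (M i : Measure Ω)) (fun _ _ => Measure.zero_le _) hi
    have hae : ∀ᵐ ω ∂Q, ENNReal.ofReal (h i ω) = (M i : Measure Ω).rnDeriv Q ω := by
      filter_upwards [Measure.rnDeriv_le_one_of_le hMQ] with ω hω
      rw [hh]
      dsimp only
      rw [ENNReal.ofReal_toReal (ne_top_of_le_ne_top ENNReal.one_ne_top (min_le_right _ _)),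
        min_eq_left (show _ ≤ (1 : ℝ≥0∞) from hω)]
    rw [hinter, measureReal_def, hν, prod_restrict_Ioo_regionBetween P (hmeas i) (hle i) hE, hP,
      Measure.restrict_smul, lintegral_smul_measure,
      lintegral_congr_ae (ae_restrict_of_ae hae),
      Measure.setLIntegral_rnDeriv (Measure.absolutelyContinuous_of_le hMQ), smul_eq_mul,
      ENNReal.toReal_mul, measureReal_def]
    simp
  have hcard : (1 : ℝ) ≤ F.card := by exact_mod_cast hF.card_pos
  have hGm : ∀ i, MeasurableSet (regionBetween 0 (h i) Set.univ) := fun i =>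
    measurableSet_regionBetween measurable_const (hmeas i) MeasurableSet.univ
  refine ⟨ν, fun i => regionBetween 0 (h i) Set.univ, (F.card : ℝ)⁻¹, inferInstance,
    by positivity, inv_le_one_of_one_le₀ hcard, hGm, hG, fun i hi j hj => ?_⟩
  set E : Set Ω := {ω | h j ω ≤ h i ω} with hEdef
  have hE : MeasurableSet E := measurableSet_le (hmeas j) (hmeas i)
  have hsub : (regionBetween 0 (h j) Set.univ ∩ Prod.fst ⁻¹' E) ∪
      (regionBetween 0 (h i) Set.univ ∩ Prod.fst ⁻¹' Eᶜ)
      ⊆ regionBetween 0 (h i) Set.univ ∩ regionBetween 0 (h j) Set.univ := by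
    rintro ⟨ω, t⟩ (⟨⟨-, h0, h1⟩, hω⟩ | ⟨⟨-, h0, h1⟩, hω⟩)
    · exact ⟨⟨trivial, h0, lt_of_lt_of_le h1 hω⟩, ⟨trivial, h0, h1⟩⟩
    · exact ⟨⟨trivial, h0, h1⟩, ⟨trivial, h0, h1.trans (not_le.1 hω)⟩⟩
  have hdisj : Disjoint (regionBetween 0 (h j) Set.univ ∩ Prod.fst ⁻¹' E)
      (regionBetween 0 (h i) Set.univ ∩ Prod.fst ⁻¹' Eᶜ) :=
    Set.disjoint_left.2 fun _ hy hy' => hy'.2 hy.2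
  have key := measureReal_mono (μ := ν) hsub
  rw [measureReal_union hdisj ((hGm i).inter (measurable_fst hE.compl)), hG j hj E hE,
    hG i hi _ hE.compl, probReal_compl_eq_one_sub hE] at key
  refine le_trans ?_ key
  rw [← mul_add]
  have := measureReal_sub_le_tvDistance (M i) (M j) hE
  gcongr
  linarith

/-- `μ` is a joint law of a family of random variables with the given marginals. -/
def IsCouplingOf {Ω ι : Type*} [MeasurableSpace Ω] (M : ι → ProbabilityMeasure Ω)
    (μ : ProbabilityMeasure (ι → Ω)) : Prop :=
  ∀ i, (μ : Measure (ι → Ω)).map (fun x => x i) = M i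

/-- Resample every coordinate whose acceptance region contains the proposal `y`. -/
noncomputable def resample {Ω ι : Type*} (G : ι → Set (Ω × ℝ)) (p : (ι → Ω) × (Ω × ℝ)) : ι → Ω :=
  open Classical in fun i => if p.2 ∈ G i then p.2.1 else p.1 i

section Resample

variable {Ω ι : Type*} [MeasurableSpace Ω] {G : ι → Set (Ω × ℝ)}

theorem measurable_resample (hG : ∀ i, MeasurableSet (G i)) : Measurable (resample G) := by
  classical
  refine measurable_pi_lambda _ fun i => ?_
  exact Measurable.ite (measurable_snd (hG i)) (measurable_fst.comp measurable_snd)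
    ((measurable_pi_apply i).comp measurable_fst)

theorem IsCouplingOf.resample {M : ι → ProbabilityMeasure Ω} {μ : ProbabilityMeasure (ι → Ω)}
    (hμ : IsCouplingOf M μ) (hG : ∀ i, MeasurableSet (G i)) {ν : ProbabilityMeasure (Ω × ℝ)}
    (hν : ∀ i, ∃ c, ∀ E, MeasurableSet E →
      (ν : Measure (Ω × ℝ)).real (G i ∩ Prod.fst ⁻¹' E) = c * (M i : Measure Ω).real E) :
    IsCouplingOf M ((μ.prod ν).map (measurable_resample hG).aemeasurable) := by
  intro i
  obtain ⟨c, hc⟩ := hν i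
  have hGi : (ν : Measure (Ω × ℝ)).real (G i) = c := by simpa using hc _ MeasurableSet.univ
  ext E hE
  rw [← ENNReal.toReal_eq_toReal_iff' (measure_ne_top _ _) (measure_ne_top _ _),
    ProbabilityMeasure.toMeasure_map,
    Measure.map_map (measurable_pi_apply i) (measurable_resample hG),
    Measure.map_apply ((measurable_pi_apply i).comp (measurable_resample hG)) hE]
  have hset : ((fun x : ι → Ω => x i) ∘ _root_.resample G) ⁻¹' E
      = Set.univ ×ˢ (G i ∩ Prod.fst ⁻¹' E) ∪ ((fun x : ι → Ω => x i) ⁻¹' E) ×ˢ (G i)ᶜ := by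
    ext ⟨x, y⟩
    by_cases hy : y ∈ G i <;> simp [_root_.resample, hy]
  have hdisj : Disjoint ((Set.univ : Set (ι → Ω)) ×ˢ (G i ∩ Prod.fst ⁻¹' E))
      (((fun x : ι → Ω => x i) ⁻¹' E) ×ˢ (G i)ᶜ) :=
    Set.disjoint_left.2 fun _ hy hy' => hy'.2 hy.2.1
  have hmarg : (μ : Measure (ι → Ω)).real ((fun x : ι → Ω => x i) ⁻¹' E)
      = (M i : Measure Ω).real E := by
    rw [← hμ i, map_measureReal_apply (measurable_pi_apply i) hE]
  have hm : MeasurableSet (((fun x : ι → Ω => x i) ⁻¹' E) ×ˢ (G i)ᶜ) :=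
    (measurable_pi_apply i hE).prod (hG i).compl
  rw [hset, ProbabilityMeasure.toMeasure_prod, ← measureReal_def, ← measureReal_def,
    measureReal_union hdisj hm, measureReal_prod_prod, measureReal_prod_prod, hc E hE, hmarg,
    probReal_compl_eq_one_sub (hG i), hGi]
  simp only [probReal_univ]
  ring

theorem measureReal_resample_ne_le [MeasurableEq Ω] (μ : ProbabilityMeasure (ι → Ω))
    (hG : ∀ i, MeasurableSet (G i)) (ν : ProbabilityMeasure (Ω × ℝ)) (i j : ι) :
    ((μ.prod ν).map (measurable_resample hG).aemeasurable : Measure (ι → Ω)).real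
        {x | x i ≠ x j}
      ≤ (ν : Measure (Ω × ℝ)).real (G i \ G j) + (ν : Measure (Ω × ℝ)).real (G j \ G i)
        + (μ : Measure (ι → Ω)).real {x | x i ≠ x j}
          * (1 - (ν : Measure (Ω × ℝ)).real (G i ∪ G j)) := by
  have hne : MeasurableSet {x : ι → Ω | x i ≠ x j} :=
    (measurableSet_eq_fun (measurable_pi_apply i) (measurable_pi_apply j)).compl
  rw [ProbabilityMeasure.toMeasure_map, map_measureReal_apply (measurable_resample hG) hne,
    ProbabilityMeasure.toMeasure_prod]
  have hsub : resample G ⁻¹' {x : ι → Ω | x i ≠ x j}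
      ⊆ (Set.univ ×ˢ (G i \ G j) ∪ Set.univ ×ˢ (G j \ G i))
        ∪ {x : ι → Ω | x i ≠ x j} ×ˢ (G i ∪ G j)ᶜ := by
    rintro ⟨x, y⟩ hxy
    by_cases hi : y ∈ G i <;> by_cases hj : y ∈ G j <;> simp_all [resample]
  refine (measureReal_mono hsub).trans <| (measureReal_union_le _ _).trans ?_
  refine (add_le_add_left (measureReal_union_le _ _) _).trans ?_
  rw [measureReal_prod_prod, measureReal_prod_prod, measureReal_prod_prod,
    probReal_compl_eq_one_sub ((hG i).union (hG j))]
  simp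

end Resample

theorem contraction_bound {c τ d D R : ℝ} (hc : 0 < c) (hτ : c * (1 - d) ≤ τ) (hτc : τ ≤ c)
    (hb : c + c - τ ≤ 1) (hR : 0 ≤ R) (hD : D ≤ 2 * d / (1 + d) + R) :
    (c - τ) + (c - τ) + D * (1 - (c + c - τ)) ≤ 2 * d / (1 + d) + (1 - c) * R := by
  have hd : 0 ≤ d := by nlinarith
  have hq : 2 * d / (1 + d) = 2 - 2 / (1 + d) := by field_simp; ring
  set w := 2 / (1 + d) with hw
  have hw0 : 0 < w := by positivity
  have hwd : w * (1 + d) = 2 := by rw [hw]; field_simp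
  rw [hq] at hD ⊢
  have h₁ : D * (1 - (c + c - τ)) ≤ (2 - w + R) * (1 - (c + c - τ)) :=
    mul_le_mul_of_nonneg_right hD (by linarith)
  have h₂ : w * (c + c - τ) ≤ w * (c * (1 + d)) :=
    mul_le_mul_of_nonneg_left (by linarith) hw0.le
  have h₃ : w * (c * (1 + d)) = 2 * c := by rw [← hwd]; ring
  have h₄ : 0 ≤ R * (c - τ) := mul_nonneg hR (by linarith)
  nlinarith

theorem exists_coupling_near {Ω ι : Type*} [MeasurableSpace Ω] [MeasurableEq Ω]
    (M : ι → ProbabilityMeasure Ω) (F : Finset ι) {ε : ℝ} (hε : 0 < ε) :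
    ∃ μ : ProbabilityMeasure (ι → Ω), IsCouplingOf M μ ∧ ∀ i ∈ F, ∀ j ∈ F,
      (μ : Measure (ι → Ω)).real {x | x i ≠ x j}
        ≤ 2 * tvDistance (M i) (M j) / (1 + tvDistance (M i) (M j)) + ε := by
  classical
  obtain ⟨μ₀, hprod⟩ : ∃ μ, IsCouplingOf M μ :=
    ⟨⟨Measure.infinitePi fun i => (M i : Measure Ω), inferInstance⟩, fun i =>
      Measure.infinitePi_map_eval (fun i => (M i : Measure Ω)) i⟩
  rcases F.eq_empty_or_nonempty with rfl | hF
  · exact ⟨_, hprod, by simp⟩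
  obtain ⟨ν, G, c, hνp, hc0, hc1, hGm, hG, hGG⟩ := exists_acceptanceRegions M F hF
  set G' : ι → Set (Ω × ℝ) := fun i => if i ∈ F then G i else ∅ with hG'
  have hG'm : ∀ i, MeasurableSet (G' i) := fun i => by
    by_cases hi : i ∈ F <;> simp [hG', hi, hGm]
  have hmarg : ∀ i, ∃ c, ∀ E, MeasurableSet E →
      ν.real (G' i ∩ Prod.fst ⁻¹' E) = c * (M i : Measure Ω).real E := fun i => by
    by_cases hi : i ∈ F
    · exact ⟨c, fun E hE => by simpa [hG', hi] using hG i hi E hE⟩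
    · exact ⟨0, fun E _ => by simp [hG', hi]⟩
  have hiter : ∀ N : ℕ, ∃ μ : ProbabilityMeasure (ι → Ω), IsCouplingOf M μ ∧
      ∀ i ∈ F, ∀ j ∈ F, (μ : Measure (ι → Ω)).real {x | x i ≠ x j}
        ≤ 2 * tvDistance (M i) (M j) / (1 + tvDistance (M i) (M j)) + (1 - c) ^ N := by
    intro N
    induction N with
    | zero =>
      refine ⟨_, hprod, fun i _ j _ => ?_⟩
      have hd := tvDistance_nonneg (M i) (M j)
      have hq : 0 ≤ 2 * tvDistance (M i) (M j) / (1 + tvDistance (M i) (M j)) := by positivity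
      refine measureReal_le_one.trans ?_
      simpa using hq
    | succ N ih =>
      obtain ⟨μ, hμ, hμF⟩ := ih
      refine ⟨_, hμ.resample hG'm (ν := ⟨ν, hνp⟩) hmarg, fun i hi j hj => ?_⟩
      refine (measureReal_resample_ne_le μ hG'm ⟨ν, hνp⟩ i j).trans ?_
      simp only [ProbabilityMeasure.coe_mk, hG', hi, hj, if_true]
      have hi' : ν.real (G i) = c := by simpa using hG i hi _ MeasurableSet.univ
      have hj' : ν.real (G j) = c := by simpa using hG j hj _ MeasurableSet.univ
      have h₁ := measureReal_sdiff_add_inter (μ := ν) (s := G i) (hGm j)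
      have h₂ := measureReal_sdiff_add_inter (μ := ν) (s := G j) (hGm i)
      rw [Set.inter_comm] at h₂
      have h₃ := measureReal_union_add_inter (μ := ν) (s := G i) (hGm j)
      have h₄ : ν.real (G i ∪ G j) ≤ 1 := measureReal_le_one
      have h₅ : 0 ≤ ν.real (G i \ G j) := measureReal_nonneg
      have e₁ : ν.real (G i \ G j) = c - ν.real (G i ∩ G j) := by linarith
      have e₂ : ν.real (G j \ G i) = c - ν.real (G i ∩ G j) := by linarith
      have e₃ : ν.real (G i ∪ G j) = c + c - ν.real (G i ∩ G j) := by linarith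
      rw [e₁, e₂, e₃, pow_succ, mul_comm ((1 - c) ^ N)]
      exact contraction_bound hc0 (hGG i hi j hj) (by linarith) (by linarith)
        (pow_nonneg (by linarith) N) (hμF i hi j hj)
  obtain ⟨N, hN⟩ := exists_pow_lt_of_lt_one hε (show 1 - c < 1 by linarith)
  obtain ⟨μ, hμ, hμF⟩ := hiter N
  exact ⟨μ, hμ, fun i hi j hj => (hμF i hi j hj).trans (by linarith)⟩

/-- Countably many laws on a compact metrizable space admit a simultaneous coupling in which any
two coordinates differ with probability at most `2 d / (1 + d)`, `d` being the total variation
distance of their laws. -/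
theorem exists_coupling {Ω ι : Type*} [Countable ι] [TopologicalSpace Ω] [CompactSpace Ω]
    [TopologicalSpace.MetrizableSpace Ω] [SecondCountableTopology Ω] [MeasurableSpace Ω]
    [BorelSpace Ω] (M : ι → ProbabilityMeasure Ω) :
    ∃ μ : ProbabilityMeasure (ι → Ω), IsCouplingOf M μ ∧ ∀ i j,
      (μ : Measure (ι → Ω)).real {x | x i ≠ x j}
        ≤ 2 * tvDistance (M i) (M j) / (1 + tvDistance (M i) (M j)) := by
  classical
  choose μ hμ hμF using fun p : Finset ι × ℕ =>
    exists_coupling_near M p.1 (ε := 1 / ((p.2 : ℝ) + 1)) (by positivity)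
  let L : Ultrafilter (Finset ι × ℕ) := Ultrafilter.of Filter.atTop
  have hL : (L : Filter (Finset ι × ℕ)) ≤ Filter.atTop := Ultrafilter.of_le _
  obtain ⟨μ₀, -, hlim⟩ := isCompact_univ.ultrafilter_le_nhds (L.map μ) (by simp)
  have hlim : Filter.Tendsto μ L (nhds μ₀) := hlim
  refine ⟨μ₀, fun i => ?_, fun i j => ?_⟩
  · have hc : Continuous fun x : ι → Ω => x i := continuous_apply i
    have h₁ := ProbabilityMeasure.tendsto_map_of_tendsto_of_continuous μ μ₀ hlim hc
    have h₂ : (fun p => (μ p).map hc.measurable.aemeasurable) = fun _ => M i := by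
      funext p
      exact Subtype.ext (hμ p i)
    rw [h₂] at h₁
    have h₃ := tendsto_nhds_unique h₁ tendsto_const_nhds
    exact congrArg ProbabilityMeasure.toMeasure h₃
  · have hopen : IsOpen {x : ι → Ω | x i ≠ x j} :=
      isOpen_ne_fun (continuous_apply i) (continuous_apply j)
    have hport := ProbabilityMeasure.le_liminf_measure_open_of_tendsto hlim hopen
    have hd := tvDistance_nonneg (M i) (M j)
    have hq : 0 ≤ 2 * tvDistance (M i) (M j) / (1 + tvDistance (M i) (M j)) := by positivity
    refine le_of_forall_pos_le_add fun ε hε => ?_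
    obtain ⟨k, hk⟩ := exists_nat_one_div_lt hε
    refine ENNReal.toReal_le_of_le_ofReal (by positivity) (hport.trans ?_)
    refine Filter.liminf_le_of_frequently_le' (Filter.Eventually.frequently ?_)
    filter_upwards [hL (Filter.Ici_mem_atTop (({i, j} : Finset ι), k))] with p hp
    have hp : ({i, j} : Finset ι) ⊆ p.1 ∧ k ≤ p.2 := hp
    rw [← ENNReal.ofReal_toReal (measure_ne_top (μ p : Measure (ι → Ω)) _)]
    refine ENNReal.ofReal_le_ofReal ((hμF p i (hp.1 (by simp)) j (hp.1 (by simp))).trans ?_)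
    have h₁ : 1 / ((p.2 : ℝ) + 1) ≤ 1 / ((k : ℝ) + 1) :=
      one_div_le_one_div_of_le (by positivity) (by have := hp.2; gcongr)
    linarith

theorem measureReal_prod_eq_integral_section {α β : Type*} [MeasurableSpace α] [MeasurableSpace β]
    (μ : Measure α) (ν : Measure β) [IsFiniteMeasure ν] {s : Set (α × β)}
    (hs : MeasurableSet s) :
    (μ.prod ν).real s = ∫ a, ν.real (Prod.mk a ⁻¹' s) ∂μ := by
  rw [measureReal_def, Measure.prod_apply hs]
  exact (integral_toReal (measurable_measure_prodMk_left hs).aemeasurable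
    (ae_of_all _ fun _ => measure_lt_top _ _)).symm

theorem two_mul_div_one_add_le_tangent {d ρ : ℝ} (hd : 0 ≤ d) (hρ : 0 ≤ ρ) :
    2 * d / (1 + d) ≤ 2 * ρ / (1 + ρ) + 2 / (1 + ρ) ^ 2 * (d - ρ) := by
  have h : 2 * ρ / (1 + ρ) + 2 / (1 + ρ) ^ 2 * (d - ρ) - 2 * d / (1 + d)
      = 2 * (d - ρ) ^ 2 / ((1 + ρ) ^ 2 * (1 + d)) := by
    field_simp
    ring
  have : 0 ≤ 2 * (d - ρ) ^ 2 / ((1 + ρ) ^ 2 * (1 + d)) := by positivity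
  linarith

theorem LearningRule.isProbabilityMeasure_mixture {X : Type u} {n : ℕ} (A : LearningRule X n)
    (s : ℕ → LabeledSample X n) : IsProbabilityMeasure (LearningRule.mixture A s) := by
  refine ⟨?_⟩
  rw [LearningRule.mixture, Measure.sum_apply _ MeasurableSet.univ]
  simp only [Measure.smul_apply, measure_univ, smul_eq_mul, mul_one]
  rw [ENNReal.tsum_geometric_add_one, ENNReal.one_sub_inv_two, inv_inv,
    ENNReal.inv_mul_cancel (by simp) (by simp)]

theorem LearningRule.absolutelyContinuous_mixture {X : Type u} {n : ℕ} (A : LearningRule X n)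
    (s : ℕ → LabeledSample X n) (i : ℕ) :
    (A (s i) : Measure (X → Bool)) ≪ LearningRule.mixture A s := by
  have h := Measure.le_sum (fun i => (2⁻¹ : ℝ≥0∞) ^ (i + 1) • (A (s i) : Measure (X → Bool))) i
  exact (Measure.absolutelyContinuous_smul (by simp)).trans (Measure.absolutelyContinuous_of_le h)

theorem mainTheorem3 {X : Type u} [Countable X] [MeasurableSpace X] [MeasurableSingletonClass X]
    (n : ℕ) (ρ : ℝ) (A : LearningRule X n) (hA : IsTVIndistinguishable A ρ) :
    (∃ A' : LearningAlgorithm X n,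
      LearningRule.Equivalent A A'.rule ∧ A'.IsReplicable (2 * ρ / (1 + ρ))) ∧
    (∀ s : ℕ → LabeledSample X n, Function.Surjective s →
      IsProbabilityMeasure (LearningRule.mixture A s) ∧
      LearningRule.IsAbsolutelyContinuous A (LearningRule.mixture A s)) := by
  refine ⟨?_, fun s hs => ⟨A.isProbabilityMeasure_mixture s, fun D => ae_of_all _ fun S => ?_⟩⟩
  · obtain ⟨μ, hμ, hne⟩ := exists_coupling A
    have hrun : Measurable (Function.uncurry
        fun (S : LabeledSample X n) (r : LabeledSample X n → X → Bool) => r S) :=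
      measurable_from_prod_countable_right fun S => measurable_pi_apply S
    refine ⟨⟨LabeledSample X n → X → Bool, μ, fun S r => r S, hrun⟩, fun S => ?_, fun D => ?_⟩
    · exact Subtype.ext (hμ S).symm
    · have : IsProbabilityMeasure (iidSample n D) := by unfold iidSample; infer_instance
      set W := (iidSample n D).prod (iidSample n D) with hW
      have hint : Integrable
          (fun p : LabeledSample X n × LabeledSample X n => tvDistance (A p.1) (A p.2)) W :=
        Integrable.of_bound (measurable_of_countable _).aestronglyMeasurable 1
          (ae_of_all _ fun p => by
            rw [Real.norm_of_nonneg (tvDistance_nonneg _ _)]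
            exact tvDistance_le_one _ _)
      have hlin : Integrable (fun p : LabeledSample X n × LabeledSample X n =>
          2 / (1 + ρ) ^ 2 * (tvDistance (A p.1) (A p.2) - ρ)) W :=
        (hint.sub (integrable_const ρ)).const_mul _
      have hρ : 0 ≤ ρ := (integral_nonneg fun p => tvDistance_nonneg _ _).trans (hA D)
      have hset : MeasurableSet {q : (LabeledSample X n × LabeledSample X n) ×
          (LabeledSample X n → X → Bool) | q.2 q.1.1 ≠ q.2 q.1.2} :=
        (measurableSet_eq_fun
          (hrun.comp ((measurable_fst.comp measurable_fst).prodMk measurable_snd))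
          (hrun.comp ((measurable_snd.comp measurable_fst).prodMk measurable_snd))).compl
      change (W.prod (μ : Measure _)).real {q : (LabeledSample X n × LabeledSample X n) ×
          (LabeledSample X n → X → Bool) | q.2 q.1.1 ≠ q.2 q.1.2} ≤ _
      rw [measureReal_prod_eq_integral_section W (μ : Measure _) hset]
      calc ∫ p, (μ : Measure _).real (Prod.mk p ⁻¹' {q : (LabeledSample X n × LabeledSample X n) ×
              (LabeledSample X n → X → Bool) | q.2 q.1.1 ≠ q.2 q.1.2}) ∂W
          ≤ ∫ p, (2 * ρ / (1 + ρ) + 2 / (1 + ρ) ^ 2 * (tvDistance (A p.1) (A p.2) - ρ)) ∂W := by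
            refine integral_mono_of_nonneg (ae_of_all _ fun _ => measureReal_nonneg)
              ((integrable_const _).add hlin)
              (ae_of_all _ fun p => ?_)
            exact (hne p.1 p.2).trans
              (two_mul_div_one_add_le_tangent (tvDistance_nonneg _ _) hρ)
        _ = 2 * ρ / (1 + ρ) + 2 / (1 + ρ) ^ 2 * (∫ p, tvDistance (A p.1) (A p.2) ∂W - ρ) := by
            rw [integral_add (integrable_const _) hlin, integral_const_mul, integral_sub hint
              (integrable_const _)]
            simp
        _ ≤ 2 * ρ / (1 + ρ) := by
            have h₁ := hA D
            have h₂ : 0 ≤ 2 / (1 + ρ) ^ 2 := by positivity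
            have h₃ := mul_nonpos_of_nonneg_of_nonpos h₂ (sub_nonpos.2 h₁)
            linarith
  · obtain ⟨i, rfl⟩ := hs S
    exact A.absolutelyContinuous_mixture s i
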